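/- Consider the $K$-user interference channel with $Y_r(t)=\sum_{j\in[K]}h_{rj}X_j(t)+Z_r(t)$ for $r\in[K]=\{1,\dots,K\}$, where each $Z_r$ is zero-mean unit-variance circularly symmetric complex Gaussian noise, i.i.d. in time, and the coefficients $h_{rj}\in\mathbb{C}$ are fixed, known everywhere, and satisfy $h_{rj}\neq 0$ if and only if $r\in\{j,j+1\}$. The messages $W_1,\dots,W_K$ are independent and uniform, $W_r$ is intended for receiver $r$, and it is available exactly at the transmitters in its transmit set $\mathcal{T}_r\subseteq[K]$. For a total average power constraint $P$ across all transmitters, the sum rate $C_\Sigma(P)$ is the supremum of $\sum_r R_r$ over all achievable rate tuples. Fix $i\in[K]$. Call $\mathcal{T}_i$ useful if no element $k\in\mathcal{T}_i$ can be removed from it (the other transmit sets being unchanged) without decreasing the sum rate, that is, for every $k\in\mathcal{T}_i$ the removal of $k$ strictly decreases $C_\Sigma(P)$ for some $P>0$. Let $G_{W_i,\mathcal{T}_i}$ be the graph with vertex set $[K]$ in which distinct $x,y$ are adjacent if and only if $x,y\in\mathcal{T}_i$ and transmitters $x$ and $y$ are both connected to some common receiver (that is, $|x-y|=1$). A vertex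 is marked if its transmitter is connected to receiver $i$; thus the marked vertices are $i$ and, if $i>1$, $i-1$. Let $M\in\mathbb{N}$. If $\mathcal{T}_i$ is useful and $|\mathcal{T}_i|\le M$, then every $k\in\mathcal{T}_i$ lies at graph distance at most $M-1$ in $G_{W_i,\mathcal{T}_i}$ from a marked vertex. Consequently $\mathcal{T}_i$ is local: $\mathcal{T}_i\subseteq[i-M,\,i+M]$. -/

import Mathlib

open MeasureTheory ProbabilityTheory
open scoped ENNReal

namespace CoMP

/-- The law of zero mean, unit variance, circularly symmetric complex Gaussian noise: the real and
imaginary parts are independent real Gaussians of variance `1/2`. -/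
noncomputable def noise : Measure ℂ :=
  ((gaussianReal 0 (1 / 2)).prod (gaussianReal 0 (1 / 2))).map Complex.measurableEquivRealProd.symm

/-- The law of the noise at one receiver over `n` channel uses (i.i.d. in time). -/
noncomputable def noiseBlock (n : ℕ) : Measure (Fin n → ℂ) :=
  Measure.pi fun _ => noise

/-- Wyner's linear asymmetric connectivity: `h i j`, the coefficient from transmitter `j` to
receiver `i`, is nonzero if and only if `i ∈ {j, j + 1}`. -/
def IsWynerAsymmetric {K : ℕ} (h : Fin K → Fin K → ℂ) : Prop :=
  ∀ i j : Fin K, h i j ≠ 0 ↔ (i : ℕ) = j ∨ (i : ℕ) = j + 1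

/-- A block code of length `n` for `K` users and the message assignment `T`
(`T i` is the set of transmitters at which message `i` is available). -/
structure Code {K : ℕ} (T : Fin K → Finset (Fin K)) (n : ℕ) where
  /-- the number of values of each message -/
  size : Fin K → ℕ
  size_pos : ∀ i, 0 < size i
  /-- the block transmitted by transmitter `j`, as a function of the messages -/
  enc : Fin K → (∀ i, Fin (size i)) → Fin n → ℂ
  /-- transmitter `j` only uses the messages available at it -/
  enc_dependsOn : ∀ j, DependsOn (enc j) {i | j ∈ T i}
  /-- the estimate of message `i` that receiver `i` forms from its received block -/
  dec : ∀ i, (Fin n → ℂ) → Fin (size i)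
  dec_measurable : ∀ i, Measurable (dec i)

namespace Code

variable {K : ℕ} {T : Fin K → Finset (Fin K)} {n : ℕ}

/-- The block received at receiver `i` when the messages are `w` and the noise is `z`. -/
noncomputable def received (c : Code T n) (h : Fin K → Fin K → ℂ) (i : Fin K)
    (w : ∀ i, Fin (c.size i)) (z : Fin n → ℂ) : Fin n → ℂ :=
  fun t => (∑ j, h i j * c.enc j w t) + z t

/-- The error probability of message `i`, for independent, uniformly distributed messages. -/
noncomputable def errorProb (c : Code T n) (h : Fin K → Fin K → ℂ) (i : Fin K) : ℝ :=
  (∑ w : (∀ i, Fin (c.size i)), (noiseBlock n).real {z | c.dec i (c.received h i w z) ≠ w i}) /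
    Fintype.card (∀ i, Fin (c.size i))

/-- The expected total energy spent by all transmitters during the block. -/
noncomputable def energy (c : Code T n) : ℝ :=
  (∑ w : (∀ i, Fin (c.size i)), ∑ j, ∑ t, ‖c.enc j w t‖ ^ 2) /
    Fintype.card (∀ i, Fin (c.size i))

end Code

/-- The rate tuple `R` (in nats per channel use) is achievable under the total average power
constraint `P`: for all large block lengths there are codes of these rates that satisfy the power
constraint and make the error probabilities of all messages simultaneously small. -/
def Achievable {K : ℕ} (h : Fin K → Fin K → ℂ) (T : Fin K → Finset (Fin K)) (P : ℝ)
    (R : Fin K → ℝ) : Prop :=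
  (∀ i, 0 ≤ R i) ∧
    ∀ ε : ℝ, 0 < ε → ∃ N : ℕ, ∀ n : ℕ, N ≤ n → ∃ c : Code T n,
      c.energy ≤ n * P ∧ ∀ i, n * R i ≤ Real.log (c.size i) ∧ c.errorProb h i ≤ ε

/-- The sum capacity: the supremum of the sum rates of all achievable rate tuples. -/
noncomputable def sumCapacity {K : ℕ} (h : Fin K → Fin K → ℂ) (T : Fin K → Finset (Fin K))
    (P : ℝ) : ℝ≥0∞ :=
  ⨆ (R : Fin K → ℝ) (_ : Achievable h T P R), ENNReal.ofReal (∑ i, R i)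

/-- The message assignment with `k` removed from the transmit set of message `i`. -/
def remove {K : ℕ} (T : Fin K → Finset (Fin K)) (i k : Fin K) : Fin K → Finset (Fin K) :=
  Function.update T i ((T i).erase k)

/-- The transmit set `T i` is useful: no element of it can be removed without decreasing the sum
rate (removal leaves the sum rate undecreased if it does so for every power `P`). -/
def IsUseful {K : ℕ} (h : Fin K → Fin K → ℂ) (T : Fin K → Finset (Fin K)) (i : Fin K) : Prop :=
  ∀ k ∈ T i, ∃ P : ℝ, 0 < P ∧ sumCapacity h (remove T i k) P < sumCapacity h T P

/-- The graph of a transmit set `S`: its vertices are all transmitters, and two distinct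
transmitters are adjacent if both belong to `S` and both are connected to a common receiver. -/
def transmitGraph {K : ℕ} (h : Fin K → Fin K → ℂ) (S : Finset (Fin K)) : SimpleGraph (Fin K) where
  Adj x y := x ≠ y ∧ x ∈ S ∧ y ∈ S ∧ ∃ r, h r x ≠ 0 ∧ h r y ≠ 0
  symm := ⟨fun _ _ ⟨hne, hx, hy, r, hrx, hry⟩ => ⟨hne.symm, hy, hx, r, hry, hrx⟩⟩
  loopless := ⟨fun _ hx => hx.1 rfl⟩

/-- A vertex of the graph of message `i` is marked if that transmitter is connected to
receiver `i`. -/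
def IsMarked {K : ℕ} (h : Fin K → Fin K → ℂ) (i v : Fin K) : Prop :=
  h i v ≠ 0

end CoMP

namespace CoMP

/-! If `k ∈ T i` were joined to no marked vertex, let `S` be its connected component. A receiver
that hears `S` is not receiver `i` and hears no transmitter outside `S` that has message `i`, so to
it message `i` is only shared randomness in the interference. Freezing that message at `S` to a
fixed value leaves every error probability and the energy unchanged on average over the value, so
some value is good for all of them at once (`Code.exists_freeze`). A short silent period pays for
the slight excess energy, and the vanishing rate loss gives `sumCapacity_le_of_separated`,
contradicting usefulness. The distance bounds then follow by counting the vertices of a path inside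
`T i`. -/

instance : IsProbabilityMeasure noise :=
  Measure.isProbabilityMeasure_map Complex.measurableEquivRealProd.symm.measurable.aemeasurable

instance (n : ℕ) : IsProbabilityMeasure (noiseBlock n) := by
  unfold noiseBlock; infer_instance

/-- The noise over the first `n` of `n + d` channel uses has the law of the noise over `n` uses. -/
theorem measurePreserving_castAdd (n d : ℕ) :
    MeasurePreserving (fun (z : Fin (n + d) → ℂ) t => z (Fin.castAdd d t))
      (noiseBlock (n + d)) (noiseBlock n) := by
  have hmeas : Measurable (fun (z : Fin (n + d) → ℂ) t => z (Fin.castAdd d t)) := by fun_prop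
  refine ⟨hmeas, (Measure.pi_eq fun s hs => ?_).symm⟩
  rw [Measure.map_apply hmeas (MeasurableSet.univ_pi hs)]
  have hpre : (fun (z : Fin (n + d) → ℂ) t => z (Fin.castAdd d t)) ⁻¹' Set.univ.pi s =
      Set.univ.pi (Fin.append s fun _ => Set.univ) := by
    ext z
    simp [Set.mem_pi, Fin.forall_fin_add]
  rw [hpre, noiseBlock, Measure.pi_pi, Fin.prod_univ_add]
  simp

/-! ### Padding and freezing of codes -/

namespace Code

variable {K : ℕ} {T T' : Fin K → Finset (Fin K)} {n : ℕ}

theorem measurable_received (c : Code T n) (h : Fin K → Fin K → ℂ) (r : Fin K)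
    (w : ∀ i, Fin (c.size i)) : Measurable (c.received h r w) := by
  unfold received; fun_prop

/-- The code that stays silent during `d` additional channel uses. -/
abbrev pad (c : Code T n) (d : ℕ) : Code T (n + d) where
  size := c.size
  size_pos := c.size_pos
  enc j w := Fin.append (c.enc j w) 0
  enc_dependsOn j w w' hw := congrArg (Fin.append · 0) (c.enc_dependsOn j hw)
  dec r y := c.dec r fun t => y (Fin.castAdd d t)
  dec_measurable r := (c.dec_measurable r).comp (by fun_prop)

theorem energy_pad (c : Code T n) (d : ℕ) : (c.pad d).energy = c.energy := by
  simp only [energy, Fin.sum_univ_add, Fin.append_left, Fin.append_right]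
  simp

theorem errorProb_pad (c : Code T n) (d : ℕ) (h : Fin K → Fin K → ℂ) (r : Fin K) :
    (c.pad d).errorProb h r = c.errorProb h r := by
  unfold errorProb
  congr 1
  refine Finset.sum_congr rfl fun w _ => ?_
  have hset : MeasurableSet {z | c.dec r (c.received h r w z) ≠ w r} :=
    ((c.dec_measurable r).comp (c.measurable_received h r w)) (measurableSet_singleton _).compl
  rw [← (measurePreserving_castAdd n d).measureReal_preimage hset.nullMeasurableSet]
  congr 1
  ext z
  simp only [Set.mem_ofPred_eq, Set.mem_preimage, received, Fin.append_left]
  rfl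

/-- The code in which the transmitters in `S` use the constant `q` in place of message `i`. -/
noncomputable abbrev freeze (c : Code T n) (i : Fin K) (S : Set (Fin K)) (q : Fin (c.size i))
    (hsub : ∀ r j, j ∈ T r → (r = i → j ∉ S) → j ∈ T' r) : Code T' n where
  size := c.size
  size_pos := c.size_pos
  enc j w := by classical exact if j ∈ S then c.enc j (Function.update w i q) else c.enc j w
  enc_dependsOn j w w' hw := by
    split_ifs with hj
    · refine c.enc_dependsOn j fun r hr => ?_
      rcases eq_or_ne r i with rfl | hri
      · simp
      · simpa [hri] using hw r (hsub r j hr fun e => absurd e hri)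
    · exact c.enc_dependsOn j fun r hr => hw r (hsub r j hr fun _ => hj)
  dec := c.dec
  dec_measurable := c.dec_measurable

/-- Replacing a coordinate of a uniform message tuple by an independent uniform value does not
change averages. -/
theorem sum_sum_update {ι : Type*} [Fintype ι] [DecidableEq ι] {α : ι → Type*}
    [∀ r, Fintype (α r)] (i : ι) (f : (∀ r, α r) → ℝ) :
    ∑ q : α i, ∑ w : (∀ r, α r), f (Function.update w i q) = Fintype.card (α i) * ∑ w, f w := by
  have hcard : (Fintype.card (α i) : ℝ) * ∑ w, f w = ∑ _q : α i, ∑ w, f w := by simp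
  rw [hcard, ← Fintype.sum_prod_type', ← Fintype.sum_prod_type']
  -- Exchanging the new value with the old coordinate permutes the pairs (value, tuple).
  have hinv : Function.Involutive
      (fun p : α i × (∀ r, α r) => (p.2 i, Function.update p.2 i p.1)) := fun p => by simp
  exact Equiv.sum_comp hinv.toPerm fun p => f p.2

/-! ### Averaging over the frozen value -/

variable (c : Code T n) (i : Fin K) (S : Set (Fin K))
  (hsub : ∀ r j, j ∈ T r → (r = i → j ∉ S) → j ∈ T' r)

theorem sum_energy_freeze :
    ∑ q, (c.freeze i S q hsub).energy = c.size i * c.energy := by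
  classical
  have key : ∀ j t, ∑ q : Fin (c.size i), ∑ w : (∀ r, Fin (c.size r)),
      ‖(c.freeze i S q hsub).enc j w t‖ ^ 2 = c.size i * ∑ w, ‖c.enc j w t‖ ^ 2 := by
    intro j t
    by_cases hj : j ∈ S
    · simpa [hj] using sum_sum_update i fun w => ‖c.enc j w t‖ ^ 2
    · simp [hj]
  unfold energy
  change ∑ q, (∑ w : (∀ r, Fin (c.size r)), ∑ j, ∑ t, ‖(c.freeze i S q hsub).enc j w t‖ ^ 2) /
    Fintype.card (∀ r, Fin (c.size r)) = _
  rw [← Finset.sum_div, ← mul_div_assoc]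
  congr 1
  have hswap : ∀ g : (∀ r, Fin (c.size r)) → Fin K → Fin n → ℝ,
      ∑ w, ∑ j, ∑ t, g w j t = ∑ j, ∑ t, ∑ w, g w j t := fun g => by
    rw [Finset.sum_comm]
    exact Finset.sum_congr rfl fun j _ => Finset.sum_comm
  rw [Finset.sum_congr rfl fun q _ => hswap _, hswap, Finset.sum_comm, Finset.mul_sum]
  refine Finset.sum_congr rfl fun j _ => ?_
  rw [Finset.sum_comm, Finset.mul_sum]
  exact Finset.sum_congr rfl fun t _ => key j t

/-- Every receiver sees, on average over the frozen value, the same error probability, provided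
that no receiver connected to `S` is receiver `i` or is connected to a transmitter outside `S` at
which message `i` is available. -/
theorem sum_errorProb_freeze (h : Fin K → Fin K → ℂ) (hi : ∀ s ∈ S, h i s = 0)
    (hS : ∀ r, ∀ s ∈ S, h r s ≠ 0 → ∀ j ∉ S, h r j ≠ 0 → j ∉ T i) (r : Fin K) :
    ∑ q, (c.freeze i S q hsub).errorProb h r = c.size i * c.errorProb h r := by
  classical
  unfold errorProb
  change ∑ q, (∑ w : (∀ r, Fin (c.size r)), (noiseBlock n).real
    {z | c.dec r ((c.freeze i S q hsub).received h r w z) ≠ w r}) /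
    Fintype.card (∀ r, Fin (c.size r)) = _
  rw [← Finset.sum_div, ← mul_div_assoc]
  congr 1
  by_cases hr : ∃ s ∈ S, h r s ≠ 0
  · obtain ⟨s, hs, hrs⟩ := hr
    have hri : r ≠ i := by rintro rfl; exact hrs (hi s hs)
    have hrec : ∀ q (w : ∀ r, Fin (c.size r)), (c.freeze i S q hsub).received h r w =
        c.received h r (Function.update w i q) := by
      intro q w
      funext z t
      simp only [received]
      congr 1
      refine Finset.sum_congr rfl fun j _ => ?_
      by_cases hj : j ∈ S
      · simp [hj]
      by_cases hrj : h r j = 0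
      · simp [hrj]
      -- A heard transmitter outside `S` lacks message `i`, so the whole received block is as if
      -- that message were `q`.
      have henc : c.enc j (Function.update w i q) = c.enc j w := by
        refine c.enc_dependsOn j fun l hl => ?_
        have hli : l ≠ i := by rintro rfl; exact hS r s hs hrs j hj hrj hl
        exact Function.update_of_ne hli q w
      rw [henc]
      simp [hj]
    have := sum_sum_update i fun w : (∀ r, Fin (c.size r)) =>
      (noiseBlock n).real {z | c.dec r (c.received h r w z) ≠ w r}
    simp only [Fintype.card_fin] at this
    rw [← this]
    refine Finset.sum_congr rfl fun q _ => Finset.sum_congr rfl fun w _ => ?_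
    rw [hrec, Function.update_of_ne hri]
  · push Not at hr
    have hrec : ∀ q (w : ∀ r, Fin (c.size r)), (c.freeze i S q hsub).received h r w = c.received h r w := by
      intro q w
      funext z t
      simp only [received]
      congr 1
      refine Finset.sum_congr rfl fun j _ => ?_
      by_cases hj : j ∈ S
      · simp [hr j hj]
      · simp [hj]
    simp only [hrec, Finset.sum_const, Finset.card_univ, Fintype.card_fin, nsmul_eq_mul]

theorem errorProb_nonneg (h : Fin K → Fin K → ℂ) (r : Fin K) : 0 ≤ c.errorProb h r := by
  unfold errorProb; positivity

theorem energy_nonneg : 0 ≤ c.energy := by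
  unfold energy; positivity

/-- Some frozen value costs little extra energy and keeps all error probabilities small. -/
theorem exists_freeze (h : Fin K → Fin K → ℂ) (hi : ∀ s ∈ S, h i s = 0)
    (hS : ∀ r, ∀ s ∈ S, h r s ≠ 0 → ∀ j ∉ S, h r j ≠ 0 → j ∉ T i)
    {E δ ε : ℝ} (hE : 0 < E) (hδ : δ ≤ 1) (hε : 0 < ε)
    (hen : c.energy ≤ E) (herr : ∀ r, c.errorProb h r ≤ δ * ε / (2 * K)) :
    ∃ q, (c.freeze i S q hsub).energy ≤ (1 + δ) * E ∧
      ∀ r, (c.freeze i S q hsub).errorProb h r ≤ ε := by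
  have hK : (0 : ℝ) < K := by exact_mod_cast i.pos
  have : Nonempty (Fin (c.size i)) := ⟨⟨0, c.size_pos i⟩⟩
  -- This weight lets one average control both quantities: the errors add at most `δ * E` to the
  -- mean, while a single error above `ε` would cost more than `A * ε = 2 * E ≥ (1 + δ) * E`.
  set A : ℝ := 2 * E / ε with hA
  have hApos : 0 < A := by positivity
  have hsum : ∑ q, ((c.freeze i S q hsub).energy +
      A * ∑ r, (c.freeze i S q hsub).errorProb h r) ≤ ∑ _q : Fin (c.size i), (1 + δ) * E := by
    rw [Finset.sum_add_distrib, ← Finset.mul_sum, Finset.sum_comm, c.sum_energy_freeze,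
      Finset.sum_congr rfl fun r _ => c.sum_errorProb_freeze i S hsub h hi hS r,
      ← Finset.mul_sum]
    have h1 : ∑ r, c.errorProb h r ≤ δ * ε / 2 := by
      refine (Finset.sum_le_sum fun r _ => herr r).trans_eq ?_
      simp only [Finset.sum_const, Finset.card_univ, Fintype.card_fin, nsmul_eq_mul]
      field_simp
    have h2 : A * ∑ r, c.errorProb h r ≤ δ * E := by
      refine (mul_le_mul_of_nonneg_left h1 hApos.le).trans_eq ?_
      rw [hA]; field_simp
    have h3 : (c.size i : ℝ) * (c.energy + A * ∑ r, c.errorProb h r) ≤ c.size i * ((1 + δ) * E) :=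
      mul_le_mul_of_nonneg_left (by linarith) (Nat.cast_nonneg _)
    simp only [Finset.sum_const, Finset.card_univ, Fintype.card_fin, nsmul_eq_mul]
    linarith
  obtain ⟨q, -, hq⟩ := Finset.exists_le_of_sum_le Finset.univ_nonempty hsum
  have hnn : ∀ r, 0 ≤ (c.freeze i S q hsub).errorProb h r := fun r => errorProb_nonneg _ h r
  refine ⟨q, ?_, fun r => ?_⟩
  · have := mul_nonneg hApos.le (Finset.sum_nonneg fun r (_ : r ∈ Finset.univ) => hnn r)
    linarith
  · have h1 := Finset.single_le_sum (fun r _ => hnn r) (Finset.mem_univ r)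
    have h2 : A * (c.freeze i S q hsub).errorProb h r ≤ A * ε := by
      have h3 := mul_le_mul_of_nonneg_left h1 hApos.le
      have h4 : A * ε = 2 * E := by rw [hA]; field_simp
      have h5 := (c.freeze i S q hsub).energy_nonneg
      nlinarith
    exact le_of_mul_le_mul_left h2 hApos

end Code

/-! ### From codes to the sum capacity -/

variable {K : ℕ} {T T' : Fin K → Finset (Fin K)} {h : Fin K → Fin K → ℂ}

/-- Any fraction of a rate tuple survives when message `i` is withdrawn from a set of transmitters
that does not reach receiver `i` and shares no receiver with the other transmitters of message
`i`. -/
theorem Achievable.smul_of_separated (i : Fin K) (S : Set (Fin K))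
    (hsub : ∀ r j, j ∈ T r → (r = i → j ∉ S) → j ∈ T' r) (hi : ∀ s ∈ S, h i s = 0)
    (hS : ∀ r, ∀ s ∈ S, h r s ≠ 0 → ∀ j ∉ S, h r j ≠ 0 → j ∉ T i)
    {P : ℝ} (hP : 0 < P) {R : Fin K → ℝ} (hR : Achievable h T P R)
    {δ : ℝ} (hδ0 : 0 < δ) (hδ1 : δ < 1) : Achievable h T' P fun r => (1 - δ) * R r := by
  refine ⟨fun r => mul_nonneg (by linarith) (hR.1 r), fun ε hε => ?_⟩
  have hK : (0 : ℝ) < K := by exact_mod_cast i.pos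
  obtain ⟨N, hN⟩ := hR.2 (δ * ε / (2 * K)) (by positivity)
  obtain ⟨N₁, hN₁⟩ := exists_nat_ge ((N + 1) / (1 - δ))
  -- With `n` the ceiling of `(1 - δ) * m`, `(1 + δ) * n` is below `(1 - δ ^ 2) * m + (1 + δ)`; the
  -- slack `δ ^ 2 * m ≥ 2` absorbs the rounding.
  obtain ⟨N₂, hN₂⟩ := exists_nat_ge (2 / δ ^ 2)
  refine ⟨max N₁ N₂, fun m hm => ?_⟩
  have hm1 : ((N : ℝ) + 1) ≤ (1 - δ) * m := by
    have : ((N : ℝ) + 1) / (1 - δ) ≤ m := hN₁.trans (by exact_mod_cast (le_max_left _ _).trans hm)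
    rw [div_le_iff₀ (by linarith)] at this
    linarith
  have hm2 : 2 ≤ δ ^ 2 * m := by
    have : 2 / δ ^ 2 ≤ m := hN₂.trans (by exact_mod_cast (le_max_right _ _).trans hm)
    rw [div_le_iff₀ (by positivity)] at this
    linarith
  set n := ⌈(1 - δ) * (m : ℝ)⌉₊ with hn
  have hnge : (1 - δ) * (m : ℝ) ≤ n := Nat.le_ceil _
  have hnlt : (n : ℝ) < (1 - δ) * m + 1 := Nat.ceil_lt_add_one (by nlinarith)
  have hNn : N + 1 ≤ n := by exact_mod_cast hm1.trans hnge
  have hnm : (1 + δ) * (n : ℝ) ≤ m := by nlinarith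
  have hnm' : n ≤ m := by
    have : (n : ℝ) ≤ m := by nlinarith [Nat.cast_nonneg (α := ℝ) n]
    exact_mod_cast this
  have hnpos : (0 : ℝ) < n := by exact_mod_cast (Nat.succ_pos N).trans_le hNn
  obtain ⟨c, hcE, hc⟩ := hN n (by omega)
  obtain ⟨q, hqE, hq⟩ := c.exists_freeze i S hsub h hi hS (mul_pos hnpos hP) hδ1.le hε hcE
    fun r => (hc r).2
  obtain ⟨d, hd⟩ := Nat.exists_eq_add_of_le hnm'
  clear_value n
  subst hd
  refine ⟨(c.freeze i S q hsub).pad d, ?_, fun r => ⟨?_, ?_⟩⟩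
  · rw [Code.energy_pad]
    refine hqE.trans ?_
    rw [← mul_assoc]
    exact mul_le_mul_of_nonneg_right hnm hP.le
  · refine le_trans ?_ (hc r).1
    rw [← mul_assoc]
    exact mul_le_mul_of_nonneg_right (by linarith) (hR.1 r)
  · rw [Code.errorProb_pad]
    exact hq r

theorem sumCapacity_le_of_separated (i : Fin K) (S : Set (Fin K))
    (hsub : ∀ r j, j ∈ T r → (r = i → j ∉ S) → j ∈ T' r) (hi : ∀ s ∈ S, h i s = 0)
    (hS : ∀ r, ∀ s ∈ S, h r s ≠ 0 → ∀ j ∉ S, h r j ≠ 0 → j ∉ T i)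
    {P : ℝ} (hP : 0 < P) : sumCapacity h T P ≤ sumCapacity h T' P := by
  refine iSup₂_le fun R hR => ?_
  have hlim : Filter.Tendsto (fun δ : ℝ => ENNReal.ofReal ((1 - δ) * ∑ r, R r))
      (nhdsWithin 0 (Set.Ioi 0)) (nhds (ENNReal.ofReal (∑ r, R r))) := by
    have hcont : Continuous fun δ : ℝ => ENNReal.ofReal ((1 - δ) * ∑ r, R r) :=
      ENNReal.continuous_ofReal.comp (by fun_prop)
    simpa using (hcont.tendsto 0).mono_left nhdsWithin_le_nhds
  refine le_of_tendsto hlim ?_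
  filter_upwards [Ioo_mem_nhdsGT (zero_lt_one' ℝ)] with δ hδ
  rw [Finset.mul_sum]
  exact le_iSup₂_of_le _ (hR.smul_of_separated i S hsub hi hS hP hδ.1 hδ.2) le_rfl

/-! ### Components and distances in the transmit graph -/

theorem mem_of_reachable {S : Finset (Fin K)} {k s : Fin K} (hk : k ∈ S)
    (hks : (transmitGraph h S).Reachable k s) : s ∈ S := by
  obtain ⟨p⟩ := hks
  induction p with
  | nil => exact hk
  | cons hadj _ ih => exact ih hadj.2.2.1

/-- An element of a useful transmit set is connected to a marked vertex. -/
theorem IsUseful.exists_reachable {i : Fin K} (hT : IsUseful h T i) {k : Fin K} (hk : k ∈ T i) :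
    ∃ v, IsMarked h i v ∧ (transmitGraph h (T i)).Reachable k v := by
  by_contra! hcon
  obtain ⟨P, hP, hlt⟩ := hT k hk
  -- Message `i` is withdrawn from the whole component, which is more than removing `k`; the
  -- resulting code is still valid for `remove T i k`.
  refine hlt.not_ge (sumCapacity_le_of_separated i
    {s | (transmitGraph h (T i)).Reachable k s} (fun r j hj hne => ?_) (fun s hs => ?_) ?_ hP)
  · rcases eq_or_ne r i with rfl | hri
    · have hjk : j ≠ k := by rintro rfl; exact hne rfl (SimpleGraph.Reachable.refl _)
      simp [remove, hj, hjk]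
    · simpa [remove, hri] using hj
  · by_contra hne
    exact hcon s hne hs
  · intro r s hs hrs j hj hrj hjT
    refine hj (SimpleGraph.Reachable.trans hs (SimpleGraph.Adj.reachable
      ⟨?_, mem_of_reachable hk hs, hjT, r, hrs, hrj⟩))
    rintro rfl
    exact hj hs

/-- A path from `k` never leaves `S` and repeats no vertex, so it has at most `S.card` vertices and
one edge fewer. -/
theorem edist_le_of_reachable {S : Finset (Fin K)} {k v : Fin K} (hk : k ∈ S)
    (hkv : (transmitGraph h S).Reachable k v) :
    (transmitGraph h S).edist k v ≤ ((S.card - 1 : ℕ) : ℕ∞) := by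
  obtain ⟨p, hp⟩ := hkv.exists_isPath
  refine p.edist_le.trans ?_
  have hsub : p.support.toFinset ⊆ S := fun x hx => by
    obtain ⟨q, -, -⟩ := SimpleGraph.Walk.mem_support_iff_exists_append.1 (List.mem_toFinset.1 hx)
    exact mem_of_reachable hk q.reachable
  have hcard := Finset.card_le_card hsub
  rw [List.toFinset_card_of_nodup hp.support_nodup, SimpleGraph.Walk.length_support] at hcard
  exact_mod_cast (by omega : p.length ≤ S.card - 1)

/-- Transmitters sharing a receiver `r` have index `r` or `r - 1`, so each edge moves the index by
at most one. -/
theorem IsWynerAsymmetric.abs_sub_le_length (hh : IsWynerAsymmetric h) {S : Finset (Fin K)}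
    {x y : Fin K} (p : (transmitGraph h S).Walk x y) :
    |((x : ℕ) : ℤ) - ((y : ℕ) : ℤ)| ≤ p.length := by
  induction p with
  | nil => simp
  | cons hadj p ih =>
    obtain ⟨r, hx, hy⟩ := hadj.2.2.2
    rw [hh] at hx hy
    rw [SimpleGraph.Walk.length_cons]
    push_cast
    rw [abs_le] at ih ⊢
    omega

end CoMP

theorem corollary1 (K M : ℕ) (h : Fin K → Fin K → ℂ) (hh : CoMP.IsWynerAsymmetric h)
    (T : Fin K → Finset (Fin K)) (i : Fin K) (hT : CoMP.IsUseful h T i)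
    (hM : (T i).card ≤ M) :
    (∀ k ∈ T i, ∃ v, CoMP.IsMarked h i v ∧ (v = i ∨ (v : ℕ) + 1 = i) ∧
      (CoMP.transmitGraph h (T i)).edist k v ≤ ((M - 1 : ℕ) : ℕ∞)) ∧
    ∀ k ∈ T i, ((k : ℕ) : ℤ) ∈ Set.Icc (((i : ℕ) : ℤ) - M) (((i : ℕ) : ℤ) + M) := by
  have hdist : ∀ k ∈ T i, ∃ v, CoMP.IsMarked h i v ∧ (v = i ∨ (v : ℕ) + 1 = i) ∧
      (CoMP.transmitGraph h (T i)).edist k v ≤ ((M - 1 : ℕ) : ℕ∞) := by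
    intro k hk
    obtain ⟨v, hv, hkv⟩ := hT.exists_reachable hk
    refine ⟨v, hv, ?_, (CoMP.edist_le_of_reachable hk hkv).trans ?_⟩
    · rcases (hh i v).1 hv with hiv | hiv
      · exact Or.inl (Fin.ext hiv.symm)
      · exact Or.inr hiv.symm
    · exact_mod_cast Nat.sub_le_sub_right hM 1
  refine ⟨hdist, fun k hk => ?_⟩
  obtain ⟨v, -, hvi, hkv⟩ := hdist k hk
  obtain ⟨p, hp⟩ := SimpleGraph.exists_walk_of_edist_ne_top
    (hkv.trans_lt (ENat.natCast_lt_top _)).ne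
  have hlen : p.length ≤ M - 1 := by
    rw [← hp] at hkv
    exact_mod_cast hkv
  -- Positivity makes the truncated `M - 1` a true difference; the step lost when `v` is `i - 1`
  -- then brings the bound to `M`.
  have hpos : 0 < M := (Finset.card_pos.2 ⟨k, hk⟩).trans_le hM
  have habs := hh.abs_sub_le_length p
  have hvi' : (v : ℕ) = i ∨ (v : ℕ) + 1 = i := hvi.imp_left (congrArg _)
  rw [abs_le] at habs
  rw [Set.mem_Icc]
  omega
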